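/- A lattice path is a finite sequence of steps $\mathsf{E}=(1,0)$, $\mathsf{N}=(0,1)$, $\mathsf{D}=(1,1)$. For integers $\alpha\ge 1$ and $n\ge 0$ let $\mathcal{S}_n(\alpha)$ be the set of lattice paths from $(0,0)$ to $(n,\alpha n)$ that stay weakly above the line $y=\alpha x$ (rational Schröder paths of slope $\alpha$). For $j\ge 1$ let $\mathcal{SP}^\wedge_j$ be the set of Schröder paths in $\mathcal{S}_j(1)$ that lie strictly above the diagonal $y=x$ except at their two endpoints, where for $j=1$ the single step $\mathsf{D}$ is also included; put $\sigma_j=\#\mathcal{SP}^\wedge_j$. For $a\ge 0$ and a sequence $\mathbf{c}=(c_1,c_2,\dots)$ of non-negative integers let $\mathfrak{D}^{\mathbf{c}}_n(a,1)$ be the set of Dyck words of semilength $(a+1)n$ that are concatenations of strings $d$ and $u^{(a+1)j}d^{j}$ $(1\le j\le n)$, in which each maximal ascent $u^{(a+1)j}$ is colored in one of $c_j$ ways. Denote by $(s_m)_{m\ge 0}=1,1,3,11,45,\dots$ the little Schröder numbers. **Theorem.** For all integers $\alpha\ge 1$ and $n\ge 0$, the sets $\mathcal{S}_n(\alpha)$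 and $\mathfrak{D}^{\boldsymbol\sigma}_n(\alpha-1,1)$ are finite and $$\#\mathcal{S}_n(\alpha)=\#\mathfrak{D}^{\boldsymbol\sigma}_n(\alpha-1,1),$$ where $\mathcal{SP}^\wedge_j$ is finite and $\sigma_j=2s_{j-1}$ for every $j\ge 1$. Moreover, when the colors of an ascent $u^{\alpha j}$ are taken to be the paths in $\mathcal{SP}^\wedge_j$, the following map $\xi$ is a bijection from $\mathcal{S}_n(\alpha)$ to $\mathfrak{D}^{\boldsymbol\sigma}_n(\alpha-1,1)$. Given $p\in\mathcal{S}_n(\alpha)$, walk along $p$ backwards from $(n,\alpha n)$ to $(0,0)$ and write the colored word $\xi(p)$ from left to right; at the current point $(x,y)$ of $p$: - if the step of $p$ ending at $(x,y)$ is $\mathsf{D}$, append $u^{\alpha}d$ with the ascent colored by the path $\mathsf{D}$, and move to $(x-1,y-1)$; - if it is $\mathsf{N}$, append $d$ and move to $(x,y-1)$; - if it is $\mathsf{E}$, let $(x-j,y-j)$, $j\ge 1$, be the next point, going backwards, at which $p$ meets the line of slope $1$ through $(x,y)$; append $u^{\alpha j}d^{j}$ with the ascent colored by the part of $p$ between $(x-j,y-j)$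 and $(x,y)$ (translated to start at the origin), and move to $(x-j,y-j)$. -/

import Mathlib

namespace RationalSchroder

/-- The three kinds of steps: east `E = (1,0)`, north `N = (0,1)`, diagonal `D = (1,1)`. -/
inductive Step
  | E
  | N
  | D
  deriving DecidableEq

/-- A lattice path starting at `(0,0)` is the list of its steps; `xCoord p` is the first
coordinate of its endpoint. -/
def xCoord (p : List Step) : ℕ := p.count Step.E + p.count Step.D

/-- The second coordinate of the endpoint of a lattice path starting at `(0,0)`. -/
def yCoord (p : List Step) : ℕ := p.count Step.N + p.count Step.D

/-- The rational Schröder paths of slope `α`: the paths from `(0,0)` to `(n, α n)` that stay weakly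
above the line `y = α x`. The lattice points visited are the endpoints of the prefixes, and a step
between two points of the half-plane `α x ≤ y` stays inside that half-plane. -/
def schroderPaths (α n : ℕ) : Set (List Step) :=
  {p | xCoord p = n ∧ yCoord p = α * n ∧ ∀ q, q <+: p → α * xCoord q ≤ yCoord q}

/-- The (classical, slope `1`) Schröder paths from `(0,0)` to `(n,n)` that, apart from their
endpoints, lie strictly above the diagonal `y = x`, together with the single diagonal step
when `n = 1`. -/
def strictPaths (n : ℕ) : Set (List Step) :=
  {p | p ∈ schroderPaths 1 n ∧
    (p = [Step.D] ∨ ∀ q, q <+: p → q ≠ [] → q ≠ p → xCoord q < yCoord q)}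

/-- The sequence `σ` enumerating the strict Schröder paths. -/
noncomputable def sigma (j : ℕ) : ℕ := (strictPaths j).ncard

/-- The little Schröder numbers `1, 1, 3, 11, 45, …`, indexed from `0`. Mathlib's
`Nat.smallSchroder` is the sequence `1, 1, 1, 3, 11, 45, …`, that is, shifted by one. -/
def littleSchroder (m : ℕ) : ℕ := Nat.smallSchroder (m + 1)

/-- The string `u^{(a+1) j} d^j`. -/
def block (a j : ℕ) : List DyckStep :=
  List.replicate ((a + 1) * j) DyckStep.U ++ List.replicate j DyckStep.D

/-- The Dyck words of semilength `(a+1) n` that are concatenations of strings, each of which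
is either `d` or `u^{(a+1) j} d^j` with `1 ≤ j ≤ n`. -/
def blockDyckWords (a n : ℕ) : Set (List DyckStep) :=
  {w | (∃ W : DyckWord, W.toList = w ∧ W.semilength = (a + 1) * n) ∧
    ∃ bs : List (List DyckStep),
      (∀ b ∈ bs, b = [DyckStep.D] ∨ ∃ j, 1 ≤ j ∧ j ≤ n ∧ b = block a j) ∧ w = bs.flatten}

/-- The lengths, from left to right, of the maximal ascents of a word, i.e. of the maximal
nonempty runs of `u`'s (cut the word at every `d` and discard the empty pieces). -/
def ascentLengths (w : List DyckStep) : List ℕ :=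
  ((w.splitOn DyckStep.D).map List.length).filter (fun l => 0 < l)

/-- The colored Dyck words: pairs of a word of `blockDyckWords a n` and the list of the colors of
its maximal ascents, from left to right, where an ascent of length `(a+1) j` gets a color from
the set `C j`. -/
def coloredDyckWords {κ : Type*} (C : ℕ → Set κ) (a n : ℕ) : Set (List DyckStep × List κ) :=
  {q | q.1 ∈ blockDyckWords a n ∧
    List.Forall₂ (fun l c => ∃ j, l = (a + 1) * j ∧ c ∈ C j) (ascentLengths q.1) q.2}

/-- The colored Dyck words in which an ascent of length `(a+1) j` may be colored in `c j` different
ways. -/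
def numColoredDyckWords (c : ℕ → ℕ) (a n : ℕ) : Set (List DyckStep × List ℕ) :=
  coloredDyckWords (fun j => {i | i < c j}) a n

/-- Walk a path backwards, given by the list of its steps in reverse order, from a point that lies
`h` above a line of slope `1`, up to the first point on that line. Returns the steps walked and
the remaining ones, both in reverse order. -/
def cut : ℕ → List Step → List Step × List Step
  | 0, r => ([], r)
  | _ + 1, [] => ([], [])
  | h + 1, Step.E :: r => (Step.E :: (cut (h + 2) r).1, (cut (h + 2) r).2)
  | h + 1, Step.N :: r => (Step.N :: (cut h r).1, (cut h r).2)
  | h + 1, Step.D :: r => (Step.D :: (cut (h + 1) r).1, (cut (h + 1) r).2)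

theorem length_cut_le (h : ℕ) (r : List Step) : (cut h r).2.length ≤ r.length := by
  induction r generalizing h with
  | nil => cases h <;> simp [cut]
  | cons s r ih =>
    cases h with
    | zero => simp [cut]
    | succ h => cases s <;> simp only [cut, List.length_cons] <;> exact (ih _).trans (Nat.le_succ _)

/-- The map `ξ` on a path that is given by the list of its steps in reverse order.
A step `D` contributes the block `u^α d` with color `D`; a step `N` contributes a single `d`;
for a step `E`, the piece `p` of the path back to the first point on the line of slope `1` through
the current point contributes `u^{α j} d^j` with color `p`, where `j` is the horizontal extent
of `p`. -/
def xiRev (α : ℕ) : List Step → List DyckStep × List (List Step)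
  | [] => ([], [])
  | Step.D :: r =>
    (List.replicate α DyckStep.U ++ DyckStep.D :: (xiRev α r).1, [Step.D] :: (xiRev α r).2)
  | Step.N :: r => (DyckStep.D :: (xiRev α r).1, (xiRev α r).2)
  | Step.E :: r =>
    let p := (Step.E :: (cut 1 r).1).reverse
    let j := xCoord p
    (List.replicate (α * j) DyckStep.U ++ List.replicate j DyckStep.D ++ (xiRev α (cut 1 r).2).1,
      p :: (xiRev α (cut 1 r).2).2)
termination_by r => r.length
decreasing_by
  all_goals have := length_cut_le 1 r
  all_goals simp only [List.length_cons]; omega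

/-- The map `ξ`: walk the path from its endpoint back to `(0,0)` and write the colored Dyck word
from left to right. -/
def xi (α : ℕ) (p : List Step) : List DyckStep × List (List Step) := xiRev α p.reverse

end RationalSchroder

namespace RationalSchroder

open List

/-! Paths and colored words are two readings of one list of pieces, where a piece is a step `N` or a
strict Schröder path. A path weakly above `y = x` splits into pieces from its end: a final `N` or
`D` is a piece, and a final `E` closes the strict path found by walking back to the line of slope 1
through the endpoint (`exists_pathOf_eq`). A colored word splits into letters `d` and colored blocks
(`exists_wordOf_eq`), and `ξ` translates piece by piece (`xi_pathOf`). The list is recoverable from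
word and colors (`word_colors_injective`).

It remains to match the two positivity conditions (`above_iff_dyck`). Both need checking only at
boundaries between pieces. The list runs from the end of the path but from the start of the word, so
the path condition concerns its suffixes and the Dyck condition its prefixes. As the total satisfies
`Y = (a+1) X`, the inequality for a suffix is the one for the complementary prefix.

Numerical colors are obtained by recoloring. For `σ`, a strict path is `D` or `N p E` with `p` a
Schröder path, and splitting off the last strict piece gives the recurrence of the large Schröder
numbers. -/

/-! ### Coordinates and finiteness -/

@[simp] theorem xCoord_nil : xCoord [] = 0 := by simp [xCoord]
@[simp] theorem yCoord_nil : yCoord [] = 0 := by simp [yCoord]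

theorem xCoord_append (p q : List Step) : xCoord (p ++ q) = xCoord p + xCoord q := by
  simp only [xCoord, count_append]; omega

theorem yCoord_append (p q : List Step) : yCoord (p ++ q) = yCoord p + yCoord q := by
  simp only [yCoord, count_append]; omega

@[simp] theorem xCoord_reverse (p : List Step) : xCoord p.reverse = xCoord p := by
  simp [xCoord]

@[simp] theorem yCoord_reverse (p : List Step) : yCoord p.reverse = yCoord p := by
  simp [yCoord]

@[simp] theorem xCoord_cons_E (p : List Step) : xCoord (Step.E :: p) = xCoord p + 1 := by
  simp [xCoord]; omega
@[simp] theorem xCoord_cons_N (p : List Step) : xCoord (Step.N :: p) = xCoord p := by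
  simp [xCoord]
@[simp] theorem xCoord_cons_D (p : List Step) : xCoord (Step.D :: p) = xCoord p + 1 := by
  simp [xCoord]; omega
@[simp] theorem yCoord_cons_E (p : List Step) : yCoord (Step.E :: p) = yCoord p := by
  simp [yCoord]
@[simp] theorem yCoord_cons_N (p : List Step) : yCoord (Step.N :: p) = yCoord p + 1 := by
  simp [yCoord]; omega
@[simp] theorem yCoord_cons_D (p : List Step) : yCoord (Step.D :: p) = yCoord p + 1 := by
  simp [yCoord]; omega

theorem length_le_xCoord_add_yCoord (p : List Step) : p.length ≤ xCoord p + yCoord p := by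
  induction p with
  | nil => simp
  | cons s p ih => cases s <;> simp <;> omega

instance : Fintype Step := ⟨{Step.E, Step.N, Step.D}, fun s => by cases s <;> simp⟩

theorem finite_schroderPaths (α n : ℕ) : (schroderPaths α n).Finite := by
  refine (List.finite_length_le Step (n + α * n)).subset ?_
  rintro p ⟨hx, hy, -⟩
  have := length_le_xCoord_add_yCoord p
  simp only [Set.mem_ofPred_eq]
  omega

theorem finite_strictPaths (n : ℕ) : (strictPaths n).Finite :=
  (finite_schroderPaths 1 n).subset fun _ h => h.1

theorem xCoord_of_mem_strictPaths {j : ℕ} {p : List Step} (h : p ∈ strictPaths j) :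
    xCoord p = j := h.1.1

theorem yCoord_of_mem_strictPaths {j : ℕ} {p : List Step} (h : p ∈ strictPaths j) :
    yCoord p = j := by simpa using h.1.2.1

/-! ### Walking backwards -/

/-- After walking back along `t`, the height above the line is `h + xCoord t - yCoord t`; the
hypotheses say that it first vanishes at the end of `s`. -/
theorem cut_append (s r : List Step) (h : ℕ) (hs : h + xCoord s = yCoord s)
    (hp : ∀ t, t <+: s → t ≠ s → yCoord t < h + xCoord t) : cut h (s ++ r) = (s, r) := by
  induction s generalizing h with
  | nil => simp at hs; subst hs; simp [cut]
  | cons e s ih =>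
    obtain ⟨h, rfl⟩ : ∃ k, h = k + 1 := by
      have := hp [] nil_prefix (by simp)
      exact ⟨h - 1, by simp at this; omega⟩
    have key : ∀ t, t <+: s → t ≠ s → yCoord (e :: t) < h + 1 + xCoord (e :: t) := fun t ht hne =>
      hp _ ((prefix_cons_inj e).2 ht) (by simpa using hne)
    cases e <;> simp at hs key <;> simp only [cons_append, cut] <;>
      rw [ih _ (by omega) fun t ht hne => by have := key t ht hne; omega]

/-- The height falls by at most one per step and would end at or below zero, so the line is reached
before the steps run out. -/
theorem cut_spec (r : List Step) (h : ℕ) (hr : h + xCoord r ≤ yCoord r) :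
    (cut h r).1 ++ (cut h r).2 = r ∧ h + xCoord (cut h r).1 = yCoord (cut h r).1 ∧
      ∀ t, t <+: (cut h r).1 → t ≠ (cut h r).1 → yCoord t < h + xCoord t := by
  induction r generalizing h with
  | nil => simp at hr; subst hr; simp [cut]
  | cons e r ih =>
    cases h with
    | zero => simp [cut]
    | succ h =>
      cases e <;> simp at hr <;> simp only [cut] <;>
        [obtain ⟨h1, h2, h3⟩ := ih (h + 2) (by omega);
         obtain ⟨h1, h2, h3⟩ := ih h (by omega);
         obtain ⟨h1, h2, h3⟩ := ih (h + 1) (by omega)] <;>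
        refine ⟨by simpa using h1, by simp; omega, fun t ht hne => ?_⟩ <;>
        (rcases prefix_cons_iff.1 ht with rfl | ⟨t, rfl, ht'⟩ <;>
          [simp;
           (have := h3 t ht' (by simpa using hne); simp; omega)])

/-! ### Decomposition of a path into pieces -/

/-- The part of a path that corresponds to a piece: `none` stands for a step `N`, and `some p` for
the strict Schröder path `p`. -/
def piecePath : Option (List Step) → List Step
  | none => [Step.N]
  | some p => p

/-- The factor of a block Dyck word that corresponds to a piece. -/
def pieceWord (a : ℕ) : Option (List Step) → List DyckStep
  | none => [DyckStep.D]
  | some p => block a (xCoord p)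

/-- The path with the given pieces, listed from its end to its start. -/
def pathOf : List (Option (List Step)) → List Step
  | [] => []
  | t :: ts => pathOf ts ++ piecePath t

/-- The block Dyck word with the given pieces. -/
def wordOf (a : ℕ) (ts : List (Option (List Step))) : List DyckStep :=
  (ts.map (pieceWord a)).flatten

/-- The colors of the given pieces. -/
def colorsOf (ts : List (Option (List Step))) : List (List Step) := ts.reduceOption

/-- All pieces that are not a step `N` are nonempty strict Schröder paths. -/
def Valid (ts : List (Option (List Step))) : Prop :=
  ∀ p, some p ∈ ts → ∃ j, 1 ≤ j ∧ p ∈ strictPaths j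

theorem Valid.tail {t : Option (List Step)} {ts : List (Option (List Step))}
    (h : Valid (t :: ts)) : Valid ts := fun p hp => h p (mem_cons_of_mem _ hp)

theorem Valid.head {p : List Step} {ts : List (Option (List Step))}
    (h : Valid (some p :: ts)) : ∃ j, 1 ≤ j ∧ p ∈ strictPaths j := h p mem_cons_self

theorem valid_nil : Valid [] := fun _ h => by simp at h

theorem valid_cons_none {ts : List (Option (List Step))} : Valid (none :: ts) ↔ Valid ts := by
  simp [Valid]

theorem Valid.cons_some {p : List Step} {ts : List (Option (List Step))} {j : ℕ} (hj : 1 ≤ j)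
    (hp : p ∈ strictPaths j) (h : Valid ts) : Valid (some p :: ts) := by
  intro q hq
  rcases mem_cons.1 hq with hq | hq
  · cases hq; exact ⟨j, hj, hp⟩
  · exact h q hq

theorem singleton_D_mem_strictPaths : [Step.D] ∈ strictPaths 1 := by
  refine ⟨⟨by simp, by simp, fun q hq => ?_⟩, Or.inl rfl⟩
  rcases prefix_cons_iff.1 hq with rfl | ⟨t, rfl, ht⟩
  · simp
  · simp [prefix_nil.1 ht]

/-- A strict path other than `D` ends with a step `E`, before which it stays above the line of
slope `1` through its endpoint when walked backwards. -/
theorem exists_eq_append_E {j : ℕ} {p : List Step} (hj : 1 ≤ j) (hp : p ∈ strictPaths j)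
    (hD : p ≠ [Step.D]) : ∃ s, p = s ++ [Step.E] ∧ xCoord s + 1 = j ∧ yCoord s = j ∧
      ∀ q t, s = q ++ t → q ≠ [] → yCoord t < 1 + xCoord t := by
  have hx := xCoord_of_mem_strictPaths hp
  have hy := yCoord_of_mem_strictPaths hp
  have hs := hp.2.resolve_left hD
  rcases eq_nil_or_concat' p with rfl | ⟨s, e, rfl⟩
  · simp at hx; omega
  have hne : s ≠ [] := by
    rintro rfl
    cases e <;> simp at hx hy hD <;> omega
  have h1 := hs s (prefix_append _ _) hne (by simp)
  simp only [xCoord_append, yCoord_append] at hx hy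
  -- From a point strictly above the diagonal, a step `N` or `D` cannot end on it.
  cases e <;> simp at hx hy <;> try omega
  refine ⟨s, rfl, hx, hy, fun q t hqt hq => ?_⟩
  have h2 := hs q (by rw [hqt, append_assoc]; exact prefix_append _ _) hq
    (by rw [hqt]; simp)
  rw [hqt, xCoord_append] at hx
  rw [hqt, yCoord_append] at hy
  omega

/-! ### Pieces and the map `ξ` -/

theorem xi_pathOf (a : ℕ) (ts : List (Option (List Step))) (h : Valid ts) :
    xi (a + 1) (pathOf ts) = (wordOf a ts, colorsOf ts) := by
  unfold xi
  induction ts with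
  | nil => simp [pathOf, wordOf, colorsOf, xiRev]
  | cons t ts ih =>
    replace ih := ih h.tail
    cases t with
    | none =>
      simp [pathOf, piecePath, xiRev, ih, wordOf, colorsOf, pieceWord]
    | some p =>
      obtain ⟨j, hj, hp⟩ := h.head
      by_cases hD : p = [Step.D]
      · subst hD
        simp [pathOf, piecePath, xiRev, ih, wordOf, colorsOf, pieceWord, block]
      · obtain ⟨s, rfl, hx, hy, hs⟩ := exists_eq_append_E hj hp hD
        -- Undoing the final `E` leaves height 1. The interior of the strict path is above the line
        -- through its endpoints, so the cut stops exactly at its start.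
        have hc := cut_append s.reverse (pathOf ts).reverse 1 (by simp; omega) (by
          intro t ht hne
          obtain ⟨q, hq⟩ := ht
          have := hs q.reverse t.reverse (by rw [← reverse_append, hq, reverse_reverse]) (by
            rintro hq'
            rw [reverse_eq_nil_iff] at hq'
            subst hq'
            exact hne (by simpa using hq))
          simpa using this)
        simp only [pathOf, piecePath, reverse_append, reverse_cons, reverse_nil, nil_append,
          cons_append, xiRev, hc, ih]
        simp [wordOf, colorsOf, pieceWord, block]

/-- Split off the last piece and induct on the length. Being weakly above `y = x` suffices: it
guarantees that the walk back from a final `E` meets its line of slope 1. -/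
theorem exists_pathOf_eq (p : List Step) (hp : ∀ q, q <+: p → xCoord q ≤ yCoord q) :
    ∃ ts, Valid ts ∧ pathOf ts = p := by
  induction hl : p.length using Nat.strong_induction_on generalizing p with
  | _ l ih =>
  subst hl
  rcases eq_nil_or_concat' p with rfl | ⟨s, e, rfl⟩
  · exact ⟨[], valid_nil, rfl⟩
  have hps : ∀ q, q <+: s → xCoord q ≤ yCoord q := fun q hq => hp q (hq.trans (prefix_append _ _))
  cases e with
  | N =>
    obtain ⟨ts, hv, rfl⟩ := ih s.length (by simp) s hps rfl
    exact ⟨none :: ts, valid_cons_none.2 hv, rfl⟩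
  | D =>
    obtain ⟨ts, hv, rfl⟩ := ih s.length (by simp) s hps rfl
    exact ⟨some [Step.D] :: ts, hv.cons_some le_rfl singleton_D_mem_strictPaths, rfl⟩
  | E =>
    have htot := hp _ (prefix_refl _)
    simp only [xCoord_append, yCoord_append, xCoord_cons_E, yCoord_cons_E, xCoord_nil,
      yCoord_nil] at htot
    obtain ⟨h1, h2, h3⟩ := cut_spec s.reverse 1 (by simp; omega)
    generalize (cut 1 s.reverse).1 = c at h1 h2 h3
    generalize (cut 1 s.reverse).2 = r at h1
    obtain rfl : s = r.reverse ++ c.reverse := by rw [← reverse_append, h1, reverse_reverse]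
    obtain ⟨ts, hv, hts⟩ := ih r.reverse.length (by simp) r.reverse
      (fun q hq => hps q (hq.trans (prefix_append _ _))) rfl
    have hstrict : ∀ q, q <+: c.reverse ++ [Step.E] → q ≠ [] → q ≠ c.reverse ++ [Step.E] →
        xCoord q < yCoord q := by
      intro q hq hne hne'
      obtain ⟨t, ht⟩ := (prefix_concat_iff.1 hq).resolve_left (by simpa using hne')
      have h4 := h3 t.reverse ⟨q.reverse, by rw [← reverse_append, ht, reverse_reverse]⟩ (by
        intro hc
        rw [← hc, reverse_reverse] at ht
        exact hne (by simpa using ht))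
      have hx := congrArg xCoord ht
      have hy := congrArg yCoord ht
      simp only [xCoord_append, yCoord_append, xCoord_reverse, yCoord_reverse] at hx hy h4
      omega
    have hmem : c.reverse ++ [Step.E] ∈ strictPaths (xCoord c + 1) := by
      refine ⟨⟨by simp [xCoord_append], by simp [yCoord_append]; omega, fun q hq => ?_⟩,
        Or.inr hstrict⟩
      by_cases hne : q = []
      · simp [hne]
      by_cases hne' : q = c.reverse ++ [Step.E]
      · simp [hne', xCoord_append, yCoord_append]; omega
      · have := hstrict q hq hne hne'; omega
    exact ⟨some (c.reverse ++ [Step.E]) :: ts, hv.cons_some (by omega) hmem, by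
      simp [pathOf, piecePath, hts]⟩

/-- The first letter of the word tells the kind of the first piece, since blocks are nonempty and
start with `u`; a strict piece is then its own color. -/
theorem word_colors_injective (a : ℕ) (ts ts' : List (Option (List Step))) (h : Valid ts)
    (h' : Valid ts') (hw : wordOf a ts = wordOf a ts') (hc : colorsOf ts = colorsOf ts') :
    ts = ts' := by
  have hblock : ∀ p ts, Valid (some p :: ts) → ∃ w, wordOf a (some p :: ts) = DyckStep.U :: w := by
    intro p ts h
    obtain ⟨j, hj, hp⟩ := h.head
    obtain ⟨k, hk⟩ : ∃ k, (a + 1) * j = k + 1 := ⟨(a + 1) * j - 1, by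
      have := Nat.mul_pos (Nat.add_one_pos a) hj; omega⟩
    exact ⟨_, by
      simp only [wordOf, map_cons, flatten_cons, pieceWord, block, xCoord_of_mem_strictPaths hp, hk,
        replicate_succ, cons_append]
      rfl⟩
  have hcons : ∀ t ts, Valid (t :: ts) → wordOf a (t :: ts) ≠ [] := by
    intro t ts h
    cases t with
    | none => simp [wordOf, pieceWord]
    | some p => obtain ⟨w, hw⟩ := hblock p ts h; simp [hw]
  induction ts generalizing ts' with
  | nil =>
    cases ts' with
    | nil => rfl
    | cons t ts' => exact absurd hw.symm (hcons t ts' h')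
  | cons t ts ih =>
    cases ts' with
    | nil => exact absurd hw (hcons t ts h)
    | cons t' ts' =>
      rcases t with _ | p <;> rcases t' with _ | p'
      · rw [ih ts' h.tail h'.tail (by simpa [wordOf, pieceWord] using hw)
          (by simpa [colorsOf] using hc)]
      · obtain ⟨w, hw'⟩ := hblock p' ts' h'
        rw [hw'] at hw
        simp [wordOf, pieceWord] at hw
      · obtain ⟨w, hw'⟩ := hblock p ts h
        rw [hw'] at hw
        simp [wordOf, pieceWord] at hw
      · simp only [colorsOf, reduceOption_cons_of_some, cons.injEq] at hc
        obtain ⟨rfl, hc⟩ := hc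
        rw [ih ts' h.tail h'.tail (by simpa [wordOf] using hw) hc]

/-- `ξ` depends only on the path, and its value determines the pieces; slope 1 is enough. -/
theorem pathOf_injective (ts ts' : List (Option (List Step))) (h : Valid ts)
    (h' : Valid ts') (hp : pathOf ts = pathOf ts') : ts = ts' := by
  have := congrArg (xi (0 + 1)) hp
  rw [xi_pathOf _ _ h, xi_pathOf _ _ h', Prod.mk.injEq] at this
  exact word_colors_injective 0 ts ts' h h' this.1 this.2

/-! ### Coordinates of the pieces -/

/-- The horizontal extent of the path with the given pieces. -/
def pieceX (ts : List (Option (List Step))) : ℕ := xCoord (pathOf ts)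

/-- The vertical extent of the path with the given pieces. -/
def pieceY (ts : List (Option (List Step))) : ℕ := yCoord (pathOf ts)

theorem pieceX_cons (t : Option (List Step)) (ts : List (Option (List Step))) :
    pieceX (t :: ts) = xCoord (piecePath t) + pieceX ts := by
  simp [pieceX, pathOf, xCoord_append, add_comm]

theorem pieceY_cons (t : Option (List Step)) (ts : List (Option (List Step))) :
    pieceY (t :: ts) = yCoord (piecePath t) + pieceY ts := by
  simp [pieceY, pathOf, yCoord_append, add_comm]

theorem pieceX_append (ts ts' : List (Option (List Step))) :
    pieceX (ts ++ ts') = pieceX ts + pieceX ts' := by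
  induction ts with
  | nil => simp [pieceX, pathOf]
  | cons t ts ih => rw [cons_append, pieceX_cons, pieceX_cons, ih, add_assoc]

theorem pieceY_append (ts ts' : List (Option (List Step))) :
    pieceY (ts ++ ts') = pieceY ts + pieceY ts' := by
  induction ts with
  | nil => simp [pieceY, pathOf]
  | cons t ts ih => rw [cons_append, pieceY_cons, pieceY_cons, ih, add_assoc]

theorem prefix_or_exists_of_prefix_append {β : Type*} {q l m : List β} (h : q <+: l ++ m) :
    q <+: l ∨ ∃ r, q = l ++ r ∧ r <+: m := by
  rcases prefix_or_prefix_of_prefix h (prefix_append l m) with h1 | ⟨r, rfl⟩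
  · exact Or.inl h1
  · exact Or.inr ⟨r, rfl, (prefix_append_right_inj l).1 h⟩

theorem forall_prefix_append_iff {β : Type*} (l m : List β) (P : List β → Prop) :
    (∀ q, q <+: l ++ m → P q) ↔ (∀ q, q <+: l → P q) ∧ ∀ q, q <+: m → P (l ++ q) := by
  refine ⟨fun h => ⟨fun q hq => h q (hq.trans (prefix_append _ _)), fun q hq =>
    h _ ((prefix_append_right_inj l).2 hq)⟩, fun h q hq => ?_⟩
  rcases prefix_or_exists_of_prefix_append hq with h1 | ⟨r, rfl, hr⟩
  · exact h.1 q h1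
  · exact h.2 r hr

theorem piece_prefix {t : Option (List Step)} (ht : Valid [t]) {q : List Step}
    (hq : q <+: piecePath t) : xCoord q ≤ yCoord q ∧ xCoord q ≤ xCoord (piecePath t) ∧
      (xCoord (piecePath t) ≤ yCoord (piecePath t)) := by
  have hle : xCoord q ≤ xCoord (piecePath t) := by
    obtain ⟨r, hr⟩ := hq
    rw [← hr, xCoord_append]; omega
  cases t with
  | none =>
    simp only [piecePath, xCoord_cons_N, xCoord_nil] at hle
    simp [piecePath]; omega
  | some p =>
    obtain ⟨j, hj, hp⟩ := ht.head
    refine ⟨by simpa using hp.1.2.2 q hq, hle, by simpa [piecePath] using hp.1.2.2 p prefix_rfl⟩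

/-- On each piece `y - (a+1) x` is smallest at an endpoint. For `N` it is the start. In a strict
piece of width `j`, measured from its start, `y ≥ x` gives `y - (a+1) x ≥ -a x ≥ -a j`, which is the
value at the end. -/
theorem above_pathOf_iff (a : ℕ) (ts : List (Option (List Step))) (h : Valid ts) :
    (∀ q, q <+: pathOf ts → (a + 1) * xCoord q ≤ yCoord q) ↔
      ∀ ts', ts' <:+ ts → (a + 1) * pieceX ts' ≤ pieceY ts' := by
  induction ts with
  | nil => simp [pathOf, pieceX, pieceY]
  | cons t ts ih =>
    have ht : Valid [t] := fun p hp => h p (by simp at hp; simp [hp])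
    rw [pathOf, forall_prefix_append_iff, ih h.tail]
    simp only [suffix_cons_iff, forall_eq_or_imp, pieceX_cons, pieceY_cons, xCoord_append,
      yCoord_append]
    rw [and_comm]
    refine and_congr_left fun hs => ⟨fun h1 => ?_, fun h1 q hq => ?_⟩
    · have := h1 _ prefix_rfl
      rw [pieceX, pieceY]; linarith
    · obtain ⟨h2, h3, h4⟩ := piece_prefix ht hq
      have h5 := hs ts suffix_rfl
      cases t with
      | none =>
        simp only [pieceX, pieceY, piecePath, xCoord_cons_N, xCoord_nil] at h3 h5
        obtain h3 : xCoord q = 0 := by omega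
        rw [h3]; linarith
      | some p =>
        obtain ⟨j, hj, hp⟩ := ht.head
        simp only [pieceX, pieceY, piecePath, xCoord_of_mem_strictPaths hp,
          yCoord_of_mem_strictPaths hp] at h1 h3
        have := Nat.mul_le_mul_left a h3
        linarith

/-! ### Block words -/

theorem count_U_block (a j : ℕ) : (block a j).count DyckStep.U = (a + 1) * j := by
  simp [block, count_replicate]

theorem count_D_block (a j : ℕ) : (block a j).count DyckStep.D = j := by
  simp [block, count_replicate]

theorem count_pieceWord {a : ℕ} {t : Option (List Step)} (ht : Valid [t]) :
    (pieceWord a t).count DyckStep.U = (a + 1) * xCoord (piecePath t) ∧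
      (pieceWord a t).count DyckStep.D = yCoord (piecePath t) := by
  cases t with
  | none => simp [pieceWord, piecePath]
  | some p =>
    obtain ⟨j, hj, hp⟩ := ht.head
    simp only [pieceWord, piecePath, count_U_block, count_D_block, xCoord_of_mem_strictPaths hp,
      yCoord_of_mem_strictPaths hp, and_self]

theorem count_wordOf {a : ℕ} {ts : List (Option (List Step))} (h : Valid ts) :
    (wordOf a ts).count DyckStep.U = (a + 1) * pieceX ts ∧
      (wordOf a ts).count DyckStep.D = pieceY ts := by
  induction ts with
  | nil => simp [wordOf, pieceX, pieceY, pathOf]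
  | cons t ts ih =>
    have ht : Valid [t] := fun p hp => h p (by simp at hp; simp [hp])
    obtain ⟨h1, h2⟩ := ih h.tail
    obtain ⟨h3, h4⟩ := count_pieceWord (a := a) ht
    rw [wordOf] at h1 h2
    simp only [wordOf, map_cons, flatten_cons, count_append, h1, h2, h3, h4, pieceX_cons,
      pieceY_cons, mul_add, and_self]

/-- In a prefix of a string `d` or `u^m d^j`, either there are not more `d`'s than `u`'s, or all
`u`'s of the string occur. -/
theorem pieceWord_prefix {a : ℕ} {t : Option (List Step)} {q : List DyckStep}
    (hq : q <+: pieceWord a t) : q.count DyckStep.D ≤ q.count DyckStep.U ∨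
      q.count DyckStep.U = (pieceWord a t).count DyckStep.U ∧
        q.count DyckStep.D ≤ (pieceWord a t).count DyckStep.D := by
  have hD := hq.sublist.count_le DyckStep.D
  cases t with
  | none =>
    right
    have := hq.sublist.count_le DyckStep.U
    simp [pieceWord] at this hD ⊢
    omega
  | some p =>
    rcases prefix_or_exists_of_prefix_append hq with h | ⟨r, rfl, hr⟩
    · left
      have := h.sublist.count_le DyckStep.D
      simp [count_replicate] at this
      omega
    · right
      refine ⟨?_, hD⟩
      have := hr.sublist.count_le DyckStep.U
      simp [count_replicate] at this
      simp [pieceWord, block, count_replicate, this]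

/-- In each factor the `u`'s precede the `d`'s, so the height of the word is smallest at the ends of
factors. -/
theorem dyck_wordOf_iff (a : ℕ) (ts : List (Option (List Step))) (h : Valid ts) :
    (∀ q, q <+: wordOf a ts → q.count DyckStep.D ≤ q.count DyckStep.U) ↔
      ∀ ts', ts' <+: ts → pieceY ts' ≤ (a + 1) * pieceX ts' := by
  induction ts using List.reverseRecOn with
  | nil => simp [wordOf, pathOf, pieceX, pieceY]
  | append_singleton ts t ih =>
    have hts : Valid ts := fun p hp => h p (mem_append_left _ hp)
    have ht : Valid [t] := fun p hp => h p (mem_append_right _ hp)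
    have hw : wordOf a (ts ++ [t]) = wordOf a ts ++ pieceWord a t := by simp [wordOf]
    have hX : pieceX [t] = xCoord (piecePath t) := by simp [pieceX, pathOf]
    have hY : pieceY [t] = yCoord (piecePath t) := by simp [pieceY, pathOf]
    obtain ⟨hU, hD⟩ := count_wordOf (a := a) hts
    obtain ⟨hU', hD'⟩ := count_pieceWord (a := a) ht
    rw [hw, forall_prefix_append_iff, ih hts]
    simp only [prefix_concat_iff, forall_eq_or_imp, pieceX_append, pieceY_append, hX, hY,
      count_append, hU, hD, mul_add]
    rw [and_comm]
    refine and_congr_left fun hs => ⟨fun h1 => ?_, fun h1 q hq => ?_⟩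
    · have := h1 _ prefix_rfl
      omega
    · have := hs ts prefix_rfl
      rcases pieceWord_prefix hq with h2 | ⟨h2, h3⟩ <;> omega

/-- The path with the given pieces stays above the line if and only if the word is a Dyck word. -/
theorem above_iff_dyck (a : ℕ) (ts : List (Option (List Step))) (h : Valid ts)
    (hXY : pieceY ts = (a + 1) * pieceX ts) :
    (∀ q, q <+: pathOf ts → (a + 1) * xCoord q ≤ yCoord q) ↔
      ∀ q, q <+: wordOf a ts → q.count DyckStep.D ≤ q.count DyckStep.U := by
  rw [above_pathOf_iff a ts h, dyck_wordOf_iff a ts h]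
  -- Cut the list into a prefix and a suffix and subtract from the total `Y = (a+1) X`.
  constructor
  · rintro h1 ts' ⟨r, rfl⟩
    have := h1 r (suffix_append _ _)
    rw [pieceX_append, pieceY_append, mul_add] at hXY
    omega
  · rintro h1 ts' ⟨r, rfl⟩
    have := h1 r (prefix_append _ _)
    rw [pieceX_append, pieceY_append, mul_add] at hXY
    omega

/-! ### Maximal ascents of block words -/

@[simp] theorem ascentLengths_nil : ascentLengths [] = [] := by simp [ascentLengths]

theorem ascentLengths_cons_D (w : List DyckStep) :
    ascentLengths (DyckStep.D :: w) = ascentLengths w := by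
  have := splitOn_append_cons_self_of_not_mem (a := DyckStep.D) (xs := []) (by simp) w
  rw [nil_append] at this
  simp [ascentLengths, this]

theorem ascentLengths_replicate_D_append (j : ℕ) (w : List DyckStep) :
    ascentLengths (replicate j DyckStep.D ++ w) = ascentLengths w := by
  induction j with
  | zero => simp
  | succ j ih => rw [replicate_succ, cons_append, ascentLengths_cons_D, ih]

/-- With `j ≥ 1` the ascent is nonempty and is followed by a `d`, so it does not merge with an
ascent of `w`. -/
theorem ascentLengths_block_append (a j : ℕ) (hj : 1 ≤ j) (w : List DyckStep) :
    ascentLengths (block a j ++ w) = (a + 1) * j :: ascentLengths w := by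
  obtain ⟨j, rfl⟩ := Nat.exists_eq_add_of_le' hj
  have := splitOn_append_cons_self_of_not_mem (a := DyckStep.D)
    (xs := replicate ((a + 1) * (j + 1)) DyckStep.U) (by simp) (replicate j DyckStep.D ++ w)
  rw [block, replicate_succ (n := j), append_assoc, cons_append,
    ← ascentLengths_replicate_D_append j w, ascentLengths, this]
  simp [ascentLengths]

theorem forall₂_ascentLengths_wordOf (a : ℕ) (ts : List (Option (List Step))) (h : Valid ts) :
    Forall₂ (fun l c => ∃ j, l = (a + 1) * j ∧ c ∈ strictPaths j)
      (ascentLengths (wordOf a ts)) (colorsOf ts) := by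
  induction ts with
  | nil => simp [wordOf, colorsOf]
  | cons t ts ih =>
    replace ih := ih h.tail
    cases t with
    | none => simpa [wordOf, pieceWord, colorsOf, ascentLengths_cons_D] using ih
    | some p =>
      obtain ⟨j, hj, hp⟩ := h.head
      simp only [wordOf, map_cons, flatten_cons, pieceWord, xCoord_of_mem_strictPaths hp,
        ascentLengths_block_append a j hj, colorsOf, reduceOption_cons_of_some]
      exact .cons ⟨j, rfl, hp⟩ ih

theorem exists_wordOf_eq (a : ℕ) (bs : List (List DyckStep)) (cs : List (List Step))
    (hb : ∀ b ∈ bs, b = [DyckStep.D] ∨ ∃ j, 1 ≤ j ∧ b = block a j)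
    (hc : Forall₂ (fun l c => ∃ j, l = (a + 1) * j ∧ c ∈ strictPaths j)
      (ascentLengths bs.flatten) cs) :
    ∃ ts, Valid ts ∧ wordOf a ts = bs.flatten ∧ colorsOf ts = cs := by
  induction bs generalizing cs with
  | nil =>
    simp only [flatten_nil, ascentLengths_nil, forall₂_nil_left_iff] at hc
    exact ⟨[], valid_nil, by simp [wordOf], by simp [colorsOf, hc]⟩
  | cons b bs ih =>
    have hbs := fun b' h => hb b' (mem_cons_of_mem b h)
    rcases hb b mem_cons_self with rfl | ⟨j, hj, rfl⟩
    · rw [flatten_cons, singleton_append, ascentLengths_cons_D] at hc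
      obtain ⟨ts, hv, hw, hcs⟩ := ih cs hbs hc
      rw [wordOf] at hw
      exact ⟨none :: ts, valid_cons_none.2 hv, by simp [wordOf, pieceWord, hw],
        by simpa [colorsOf] using hcs⟩
    · rw [flatten_cons, ascentLengths_block_append a j hj, forall₂_cons_left_iff] at hc
      obtain ⟨c, cs, ⟨j', hj', hc'⟩, hcs, rfl⟩ := hc
      -- The ascent length fixes the width, so the color has the same width as the block.
      obtain rfl : j = j' := Nat.eq_of_mul_eq_mul_left (Nat.add_one_pos a) hj'
      obtain ⟨ts, hv, hw, hcs⟩ := ih cs hbs hcs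
      rw [wordOf] at hw
      exact ⟨some c :: ts, hv.cons_some hj hc', by
        simp [wordOf, pieceWord, hw, xCoord_of_mem_strictPaths hc'],
        by simpa [colorsOf] using hcs⟩

/-! ### The bijection -/

theorem pathOf_mem_iff (a n : ℕ) (ts : List (Option (List Step))) (h : Valid ts) :
    pathOf ts ∈ schroderPaths (a + 1) n ↔
      (wordOf a ts, colorsOf ts) ∈ coloredDyckWords strictPaths a n := by
  obtain ⟨hU, hD⟩ := count_wordOf (a := a) h
  constructor
  · rintro ⟨hx, hy, hab⟩
    have hXY : pieceY ts = (a + 1) * pieceX ts := by rw [pieceX, pieceY, hx, hy]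
    refine ⟨⟨⟨⟨wordOf a ts, by rw [hU, hD, hXY], fun i => (above_iff_dyck a ts h hXY).1 hab _
      (take_prefix _ _)⟩, rfl, ?_⟩, ts.map (pieceWord a), ?_, rfl⟩,
      forall₂_ascentLengths_wordOf a ts h⟩
    · rw [DyckWord.semilength]
      exact hU.trans (by rw [pieceX, hx])
    · intro b hb
      obtain ⟨t, ht, rfl⟩ := mem_map.1 hb
      cases t with
      | none => exact Or.inl rfl
      | some p =>
        obtain ⟨j, hj, hp⟩ := h p ht
        refine Or.inr ⟨j, hj, ?_, by rw [pieceWord, xCoord_of_mem_strictPaths hp]⟩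
        -- The bound `j ≤ n` holds because the widths of the pieces add up to `n`.
        obtain ⟨r, s, rfl⟩ := append_of_mem ht
        have hX : pieceX (r ++ some p :: s) = n := hx
        rw [pieceX_append, pieceX_cons, piecePath, xCoord_of_mem_strictPaths hp] at hX
        omega
  · rintro ⟨⟨⟨W, hW, hs⟩, -⟩, -⟩
    simp only at hW
    rw [DyckWord.semilength, hW, hU] at hs
    have hX : pieceX ts = n := Nat.eq_of_mul_eq_mul_left (Nat.add_one_pos a) hs
    have hXY : pieceY ts = (a + 1) * pieceX ts := by
      rw [← hU, ← hD, ← hW, W.count_U_eq_count_D]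
    refine ⟨hX, by rw [← hX]; exact hXY, (above_iff_dyck a ts h hXY).2 fun q hq => ?_⟩
    rw [← hW] at hq
    rw [prefix_iff_eq_take.1 hq]
    exact W.count_D_le_count_U _

theorem exists_pathOf_eq_of_mem {a n : ℕ} {p : List Step} (hp : p ∈ schroderPaths (a + 1) n) :
    ∃ ts, Valid ts ∧ pathOf ts = p :=
  exists_pathOf_eq p fun q hq => (Nat.le_mul_of_pos_left _ (Nat.add_one_pos a)).trans (hp.2.2 q hq)

theorem bijOn_xi (a n : ℕ) : Set.BijOn (xi (a + 1)) (schroderPaths (a + 1) n)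
    (coloredDyckWords strictPaths a n) := by
  refine ⟨fun p hp => ?_, fun p hp p' hp' heq => ?_, fun q hq => ?_⟩
  · obtain ⟨ts, hv, rfl⟩ := exists_pathOf_eq_of_mem hp
    rw [xi_pathOf a ts hv]
    exact (pathOf_mem_iff a n ts hv).1 hp
  · obtain ⟨ts, hv, rfl⟩ := exists_pathOf_eq_of_mem hp
    obtain ⟨ts', hv', rfl⟩ := exists_pathOf_eq_of_mem hp'
    rw [xi_pathOf a ts hv, xi_pathOf a ts' hv', Prod.mk.injEq] at heq
    rw [word_colors_injective a ts ts' hv hv' heq.1 heq.2]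
  · obtain ⟨w, cs⟩ := q
    obtain ⟨bs, hb, hw⟩ := hq.1.2
    have hc := hq.2
    simp only at hw hc
    subst hw
    obtain ⟨ts, hv, hw, rfl⟩ := exists_wordOf_eq a bs cs
      (fun b h => (hb b h).imp_right fun ⟨j, hj, _, hj'⟩ => ⟨j, hj, hj'⟩) hc
    rw [← hw] at hq
    exact ⟨pathOf ts, (pathOf_mem_iff a n ts hv).2 hq, by rw [xi_pathOf a ts hv, hw]⟩

/-! ### Change of colors -/

theorem forall₂_zipWith {β γ δ : Type*} {R : β → γ → Prop} {S : β → δ → Prop} (f : β → γ → δ)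
    (hf : ∀ l c, R l c → S l (f l c)) {ls : List β} {cs : List γ} (h : Forall₂ R ls cs) :
    Forall₂ S ls (zipWith f ls cs) := by
  induction h with
  | nil => simp
  | cons h _ ih => exact .cons (hf _ _ h) ih

theorem zipWith_zipWith_of_forall₂ {β γ δ : Type*} {R : β → γ → Prop} (f : β → γ → δ)
    (g : β → δ → γ) (hf : ∀ l c, R l c → g l (f l c) = c) {ls : List β} {cs : List γ}
    (h : Forall₂ R ls cs) : zipWith g ls (zipWith f ls cs) = cs := by
  induction h with
  | nil => simp
  | cons h _ ih => simp [hf _ _ h, ih]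

/-- Replace the color of each ascent of length `(a+1) j` by its image under `f j`. -/
def recolor {κ ν : Type*} (a : ℕ) (f : ℕ → κ → ν) (q : List DyckStep × List κ) :
    List DyckStep × List ν :=
  (q.1, zipWith (fun l c => f (l / (a + 1)) c) (ascentLengths q.1) q.2)

theorem mapsTo_recolor {κ ν : Type*} (a n : ℕ) {C : ℕ → Set κ} {C' : ℕ → Set ν}
    {f : ℕ → κ → ν} (hf : ∀ j, Set.MapsTo (f j) (C j) (C' j)) :
    Set.MapsTo (recolor a f) (coloredDyckWords C a n) (coloredDyckWords C' a n) := by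
  rintro q ⟨h1, h2⟩
  refine ⟨h1, forall₂_zipWith _ ?_ h2⟩
  rintro l c ⟨j, rfl, hc⟩
  refine ⟨j, rfl, ?_⟩
  rw [Nat.mul_div_cancel_left _ (Nat.add_one_pos a)]
  exact hf j hc

theorem leftInvOn_recolor {κ ν : Type*} (a n : ℕ) {C : ℕ → Set κ}
    {f : ℕ → κ → ν} {g : ℕ → ν → κ} (hf : ∀ j, Set.LeftInvOn (g j) (f j) (C j)) :
    Set.LeftInvOn (recolor a g) (recolor a f) (coloredDyckWords C a n) := by
  rintro q ⟨h1, h2⟩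
  refine Prod.ext rfl (zipWith_zipWith_of_forall₂ _ _ ?_ h2)
  rintro l c ⟨j, rfl, hc⟩
  rw [Nat.mul_div_cancel_left _ (Nat.add_one_pos a)]
  exact hf j hc

/-- Choose a bijection of color sets for each `j` and recolor; recoloring by the inverses undoes it.
-/
theorem exists_bijOn_coloredDyckWords {κ ν : Type*} [Nonempty κ] [Nonempty ν] (a n : ℕ)
    {C : ℕ → Set κ} {C' : ℕ → Set ν} (hC : ∀ j, (C j).Finite)
    (h : ∀ j, (C j).encard = (C' j).encard) :
    ∃ F, Set.BijOn F (coloredDyckWords C a n) (coloredDyckWords C' a n) := by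
  choose f hf using fun j => (hC j).exists_bijOn_of_encard_eq (h j)
  have hinv := fun j => (hf j).invOn_invFunOn
  exact ⟨recolor a f, Set.InvOn.bijOn (f' := recolor a fun j => Function.invFunOn (f j) (C j))
    ⟨leftInvOn_recolor a n fun j => (hinv j).1, leftInvOn_recolor a n fun j => (hinv j).2⟩
    (mapsTo_recolor a n fun j => (hf j).mapsTo)
    (mapsTo_recolor a n fun j => (hf j).surjOn.mapsTo_invFunOn)⟩

theorem exists_bijOn_numColoredDyckWords (a n : ℕ) : ∃ F, Set.BijOn F
    (coloredDyckWords strictPaths a n) (numColoredDyckWords sigma a n) := by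
  refine exists_bijOn_coloredDyckWords a n finite_strictPaths fun j => ?_
  have h := (Set.finite_Iio (sigma j)).cast_ncard_eq
  rw [Set.ncard_Iio_nat] at h
  rw [← (finite_strictPaths j).cast_ncard_eq]
  exact h

/-! ### Enumeration of Schröder paths and strict Schröder paths -/

/-- The initial `N` lifts `p` by one unit, turning weakly above into strictly above. -/
theorem N_append_E_mem_strictPaths_iff (j : ℕ) (p : List Step) :
    Step.N :: (p ++ [Step.E]) ∈ strictPaths (j + 1) ↔ p ∈ schroderPaths 1 j := by
  constructor
  · rintro ⟨⟨hx, hy, -⟩, h⟩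
    simp [xCoord_append, yCoord_append] at hx hy
    refine ⟨hx, by simpa using hy, fun q hq => ?_⟩
    have := h.resolve_left (by simp) (Step.N :: q)
      ((prefix_cons_inj _).2 (hq.trans (prefix_append _ _))) (by simp) (by
        intro heq
        rw [cons.injEq] at heq
        have := hq.length_le
        rw [heq.2] at this
        simp at this)
    simp at this
    omega
  · rintro ⟨hx, hy, h⟩
    rw [one_mul] at hy
    simp only [one_mul] at h
    have hstrict : ∀ q, q <+: Step.N :: (p ++ [Step.E]) → q ≠ [] → q ≠ Step.N :: (p ++ [Step.E]) →
        xCoord q < yCoord q := by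
      intro q hq h0 h1
      rcases prefix_cons_iff.1 hq with rfl | ⟨t, rfl, ht⟩
      · exact absurd rfl h0
      · have := h t ((prefix_concat_iff.1 ht).resolve_left (by simpa using h1))
        simp
        omega
    refine ⟨⟨by simp [xCoord_append, hx], by simp [yCoord_append, hy], fun q hq => ?_⟩,
      Or.inr hstrict⟩
    by_cases h0 : q = []
    · simp [h0]
    by_cases h1 : q = Step.N :: (p ++ [Step.E])
    · simp [h1, xCoord_append, yCoord_append, hx, hy]
    · have := hstrict q hq h0 h1
      omega

theorem exists_eq_N_append_E {j : ℕ} {p : List Step} (hj : 1 ≤ j) (hp : p ∈ strictPaths j)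
    (hD : p ≠ [Step.D]) : ∃ q, p = Step.N :: (q ++ [Step.E]) := by
  obtain ⟨s, rfl, hx, hy, -⟩ := exists_eq_append_E hj hp hD
  cases s with
  | nil => simp at hy; omega
  | cons e s =>
    have := hp.2.resolve_left hD [e] (by simp) (by simp) (by simp)
    cases e <;> simp at this
    exact ⟨s, rfl⟩

theorem strictPaths_succ (j : ℕ) : strictPaths (j + 1) =
    (if j = 0 then {[Step.D]} else ∅) ∪ (fun p => Step.N :: (p ++ [Step.E])) '' schroderPaths 1 j := by
  ext p
  constructor
  · intro hp
    by_cases hD : p = [Step.D]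
    · subst hD
      have := xCoord_of_mem_strictPaths hp
      simp at this
      simp [this]
    · obtain ⟨q, rfl⟩ := exists_eq_N_append_E (Nat.le_add_left 1 j) hp hD
      exact Or.inr ⟨q, (N_append_E_mem_strictPaths_iff j q).1 hp, rfl⟩
  · rintro (h | ⟨q, hq, rfl⟩)
    · split_ifs at h with hj
      · rw [Set.mem_singleton_iff.1 h, hj]
        exact singleton_D_mem_strictPaths
      · exact absurd h (Set.notMem_empty _)
    · exact (N_append_E_mem_strictPaths_iff j q).2 hq

theorem sigma_succ (j : ℕ) :
    sigma (j + 1) = (if j = 0 then 1 else 0) + (schroderPaths 1 j).ncard := by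
  have hinj : Function.Injective fun p : List Step => Step.N :: (p ++ [Step.E]) := by
    intro p q h
    simpa using h
  rw [sigma, strictPaths_succ, Set.ncard_union_eq ?_ (by split_ifs <;> simp)
    ((finite_schroderPaths 1 j).image _), Set.ncard_image_of_injective _ hinj]
  · split_ifs <;> simp
  · rw [Set.disjoint_left]
    rintro p hp ⟨q, -, rfl⟩
    split_ifs at hp <;> simp at hp

theorem append_mem_schroderPaths {i j : ℕ} {p q : List Step} (hp : p ∈ schroderPaths 1 i)
    (hq : q ∈ schroderPaths 1 j) : p ++ q ∈ schroderPaths 1 (i + j) := by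
  obtain ⟨hx, hy, hp⟩ := hp
  obtain ⟨hx', hy', hq⟩ := hq
  refine ⟨by rw [xCoord_append, hx, hx'], by rw [yCoord_append, hy, hy', mul_add],
    (forall_prefix_append_iff p q fun r => 1 * xCoord r ≤ yCoord r).2 ⟨hp, fun r hr => ?_⟩⟩
  have := hq r hr
  rw [xCoord_append, yCoord_append]
  omega

/-- Split off the last piece. It is not `N`, since the point before an `N` ending on the diagonal
would lie below it. -/
theorem bijective_append_strictPath (n : ℕ) : Function.Bijective
    (fun x : (Σ i : Fin (n + 1), schroderPaths 1 i × strictPaths (n - i + 1)) =>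
      (⟨x.2.1 ++ x.2.2, by
        have := append_mem_schroderPaths x.2.1.2 x.2.2.2.1
        rwa [show (x.1 : ℕ) + (n - x.1 + 1) = n + 1 by omega] at this⟩ :
        schroderPaths 1 (n + 1))) := by
  constructor
  · rintro ⟨i, ⟨p, hp⟩, ⟨q, hq⟩⟩ ⟨i', ⟨p', hp'⟩, ⟨q', hq'⟩⟩ h
    simp only [Subtype.mk.injEq] at h
    obtain ⟨ts, hv, rfl⟩ := exists_pathOf_eq_of_mem (a := 0) hp
    obtain ⟨ts', hv', rfl⟩ := exists_pathOf_eq_of_mem (a := 0) hp'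
    have := pathOf_injective (some q :: ts) (some q' :: ts') (hv.cons_some (by omega) hq)
      (hv'.cons_some (by omega) hq') h
    simp only [cons.injEq, Option.some.injEq] at this
    obtain ⟨rfl, rfl⟩ := this
    obtain rfl : i = i' := Fin.ext (hp.1.symm.trans hp'.1)
    rfl
  · rintro ⟨p, hp⟩
    obtain ⟨ts, hv, rfl⟩ := exists_pathOf_eq_of_mem (a := 0) hp
    obtain ⟨hx, hy, h⟩ := hp
    cases ts with
    | nil => simp [pathOf] at hx
    | cons t ts =>
      rw [pathOf, forall_prefix_append_iff] at h
      simp only [pathOf, xCoord_append, yCoord_append] at hx hy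
      have hle := h.1 _ prefix_rfl
      cases t with
      | none => simp [piecePath] at hx hy; omega
      | some q =>
        obtain ⟨j, hj, hq⟩ := hv.head
        simp only [piecePath, xCoord_of_mem_strictPaths hq, yCoord_of_mem_strictPaths hq] at hx hy
        refine ⟨⟨⟨xCoord (pathOf ts), by omega⟩, ⟨pathOf ts, rfl, by simp only; omega, h.1⟩,
          ⟨q, ?_⟩⟩, rfl⟩
        rwa [show n - xCoord (pathOf ts) + 1 = j by omega]

theorem ncard_schroderPaths_one_succ (n : ℕ) : (schroderPaths 1 (n + 1)).ncard =
    ∑ i : Fin (n + 1), (schroderPaths 1 i).ncard * sigma (n - i + 1) := by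
  have := fun i => (finite_schroderPaths 1 i).to_subtype
  have := fun i => (finite_strictPaths i).to_subtype
  rw [← Nat.card_coe_set_eq, ← Nat.card_eq_of_bijective _ (bijective_append_strictPath n),
    Nat.card_sigma]
  simp only [Nat.card_prod, Nat.card_coe_set_eq, sigma]

theorem schroderPaths_zero (α : ℕ) : schroderPaths α 0 = {[]} := by
  ext p
  refine ⟨fun ⟨hx, hy, _⟩ => ?_, ?_⟩
  · have := length_le_xCoord_add_yCoord p
    rw [hx, hy] at this
    simpa using this
  · rintro rfl
    exact ⟨by simp, by simp, fun q hq => by simp [prefix_nil.1 hq]⟩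

theorem ncard_schroderPaths_one (n : ℕ) : (schroderPaths 1 n).ncard = n.largeSchroder := by
  induction n using Nat.strong_induction_on with
  | _ n ih =>
  cases n with
  | zero => simp [schroderPaths_zero]
  | succ n =>
    rw [ncard_schroderPaths_one_succ, Nat.largeSchroder]
    -- The extra strict path `D` occurs only in width 1, that is for `i = n`; it yields the separate
    -- term of the recurrence.
    have : ∀ i : Fin (n + 1), (schroderPaths 1 i).ncard * sigma (n - i + 1) =
        (if i = Fin.last n then Nat.largeSchroder n else 0) +
          Nat.largeSchroder i * Nat.largeSchroder (n - i) := by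
      intro i
      rw [sigma_succ, ih i i.2, ih (n - i) (by omega), mul_add]
      congr 1
      by_cases hi : i = Fin.last n
      · simp [hi]
      · have : n - (i : ℕ) ≠ 0 := by
          intro h
          exact hi (Fin.ext (by simp; omega))
        simp [hi, this]
    rw [Finset.sum_congr rfl fun i _ => this i, Finset.sum_add_distrib]
    simp

theorem sigma_eq_two_mul_littleSchroder {j : ℕ} (hj : 1 ≤ j) :
    sigma j = 2 * littleSchroder (j - 1) := by
  obtain ⟨j, rfl⟩ := Nat.exists_eq_add_of_le' hj
  rw [sigma_succ, ncard_schroderPaths_one, littleSchroder, Nat.add_sub_cancel]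
  -- In width 1 the two strict paths are `D` and `NE`; in larger widths the count is a large
  -- Schröder number, twice a little one.
  by_cases h : j = 0
  · simp [h]
  · rw [Nat.two_mul_smallSchroder_succ h]
    simp [h]

end RationalSchroder

theorem mainTheorem2 (α n : ℕ) (hα : 1 ≤ α) :
    Set.BijOn (RationalSchroder.xi α) (RationalSchroder.schroderPaths α n)
      (RationalSchroder.coloredDyckWords RationalSchroder.strictPaths (α - 1) n) ∧
    (RationalSchroder.schroderPaths α n).Finite ∧
    (RationalSchroder.numColoredDyckWords RationalSchroder.sigma (α - 1) n).Finite ∧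
    (RationalSchroder.schroderPaths α n).ncard =
      (RationalSchroder.numColoredDyckWords RationalSchroder.sigma (α - 1) n).ncard ∧
    ∀ j : ℕ, 1 ≤ j → (RationalSchroder.strictPaths j).Finite ∧
      RationalSchroder.sigma j = 2 * RationalSchroder.littleSchroder (j - 1) := by
  obtain ⟨a, rfl⟩ := Nat.exists_eq_add_of_le' hα
  rw [Nat.add_sub_cancel]
  have hxi := RationalSchroder.bijOn_xi a n
  have hfin := RationalSchroder.finite_schroderPaths (a + 1) n
  obtain ⟨F, hF⟩ := RationalSchroder.exists_bijOn_numColoredDyckWords a n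
  have hcomp := hF.comp hxi
  refine ⟨hxi, hfin, hcomp.finite_iff_finite.1 hfin, ?_, fun j hj =>
    ⟨RationalSchroder.finite_strictPaths j, RationalSchroder.sigma_eq_two_mul_littleSchroder hj⟩⟩
  rw [← hcomp.image_eq, hcomp.injOn.ncard_image]
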